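/- Let $m,n\ge 1$, $n_0=\min\{m,n\}$, and for $A\in\mathbb M_{m\times n}(\mathbb C)$ let $\sigma(A)=(\sigma_1(A),\ldots,\sigma_{n_0}(A))$, $\sigma_1(A)\ge\cdots\ge\sigma_{n_0}(A)\ge 0$, be the vector of its singular values, counted with multiplicity. For $1\le p<\infty$ let $\|A\|_p=\big(\sum_{i=1}^{n_0}\sigma_i(A)^p\big)^{1/p}$ be the Schatten $p$-norm. Let $\mathcal M$ be a (real or complex) linear subspace of $\mathbb M_{m\times n}(\mathbb C)$ and let $A\in\mathbb M_{m\times n}(\mathbb C)$. For $1<p<\infty$ let $Y_p\in\mathcal M$ be the best approximation of $A$ from $\mathcal M$ in the Schatten $p$-norm, that is, $\|A-Y_p\|_p=\min_{X\in\mathcal M}\|A-X\|_p$, and put $R_p=A-Y_p$. Let $Y^{(st)}\in\mathcal M$ be the strict spectral approximation of $A$ from $\mathcal M$, that is, the vector $\sigma(A-Y^{(st)})$ is minimal in the lexicographic order among all vectors $\sigma(A-X)$ with $X\in\mathcal M$, and put $R^{(st)}=A-Y^{(st)}$. Let $\rho_1>\rho_2>\cdots>\rho_l$ be the distinct values among $\sigma_1(R^{(st)}),\ldots,\sigma_{n_0}(R^{(st)})$,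 let $s_k$ be the multiplicity of $\rho_k$ among them, and let $t_k=s_1+\cdots+s_k$. **Theorem.** Suppose that $l\ge 2$ and $s_1=1$. Then for every $i=t_1+1,t_1+2,\ldots,t_2$, $$\lim_{p\to\infty}\sigma_i(R_p)=\sigma_i(R^{(st)})=\rho_2 .$$ -/

import Mathlib

open Filter Topology

namespace Matrix

/-- The vector `σ(A) = (σ₁(A), …, σ_{n₀}(A))`, `n₀ = min m n`, of singular values of the complex
`m × n` matrix `A` in non-increasing order, with multiplicities. The index starts at `0`:
`A.singularValueVec i` is the singular value that is usually written `σ_{i+1}(A)`. -/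
noncomputable def singularValueVec {m n : ℕ} (A : Matrix (Fin m) (Fin n) ℂ) :
    Fin (min m n) → ℝ :=
  fun i => (Matrix.toEuclideanLin A).singularValues (i : ℕ)

/-- The Schatten `p`-norm (the `c_p`-norm), for `1 ≤ p < ∞`. -/
noncomputable def schattenNorm {m n : ℕ} (p : ℝ) (A : Matrix (Fin m) (Fin n) ℂ) : ℝ :=
  (∑ i, A.singularValueVec i ^ p) ^ (1 / p)

/-- `Y` is a best approximation of `A` from the subspace `M` in the Schatten `p`-norm. -/
def IsSchattenApprox {m n : ℕ} (p : ℝ) (M : Submodule ℝ (Matrix (Fin m) (Fin n) ℂ))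
    (A Y : Matrix (Fin m) (Fin n) ℂ) : Prop :=
  Y ∈ M ∧ ∀ X ∈ M, schattenNorm p (A - Y) ≤ schattenNorm p (A - X)

/-- `Y` is a strict spectral approximation of `A` from the subspace `M`: the singular value vector
`σ(A - Y)` is minimal in the lexicographic order among all `σ(A - X)`, `X ∈ M`. -/
def IsStrictSpectralApprox {m n : ℕ} (M : Submodule ℝ (Matrix (Fin m) (Fin n) ℂ))
    (A Y : Matrix (Fin m) (Fin n) ℂ) : Prop :=
  Y ∈ M ∧ ∀ X ∈ M, toLex (A - Y).singularValueVec ≤ toLex (A - X).singularValueVec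

/-- The set `{ρ₁, …, ρ_l}` of the distinct singular values among `σ₁(R), …, σ_{n₀}(R)`. -/
noncomputable def distinctSingularValues {m n : ℕ} (R : Matrix (Fin m) (Fin n) ℂ) : Finset ℝ :=
  Finset.univ.image R.singularValueVec

/-- The number `l` of distinct singular values. -/
noncomputable def numDistinct {m n : ℕ} (R : Matrix (Fin m) (Fin n) ℂ) : ℕ :=
  R.distinctSingularValues.card

/-- The distinct singular values in decreasing order `ρ₁ > ρ₂ > ⋯ > ρ_l`. The index starts at `0`:
`R.rho ⟨0, _⟩` is `ρ₁`, and `R.rho ⟨1, _⟩` is `ρ₂`. -/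
noncomputable def rho {m n : ℕ} (R : Matrix (Fin m) (Fin n) ℂ) (k : Fin R.numDistinct) : ℝ :=
  R.distinctSingularValues.orderEmbOfFin rfl k.rev

/-- The multiplicity of a distinct singular value among `σ₁(R), …, σ_{n₀}(R)`. The index starts at
`0`: `R.rhoMult ⟨0, _⟩` is the multiplicity `s₁` of `ρ₁`. -/
noncomputable def rhoMult {m n : ℕ} (R : Matrix (Fin m) (Fin n) ℂ) (k : Fin R.numDistinct) : ℕ :=
  (Finset.univ.filter fun i => R.singularValueVec i = R.rho k).card

/-- `t_k = s₁ + ⋯ + s_k`, the sum of the first `k` multiplicities. -/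
noncomputable def rhoMultSum {m n : ℕ} (R : Matrix (Fin m) (Fin n) ℂ) (k : ℕ) : ℕ :=
  ∑ j ∈ Finset.univ.filter (fun j : Fin R.numDistinct => (j : ℕ) < k), R.rhoMult j

end Matrix

/-! Write `a` for `σ(R_p)` and `s` for `σ(R^{(st)})`. Ky Fan's principle makes partial sums of
singular values convex, so on the segment from `Y_p` to `Y^{(st)}` the residual's singular values
are weakly majorized by `(1 - t) a + t s`. Optimality of `Y_p` then gives `∑ aᵢ^(p-1) (sᵢ - aᵢ) ≥ 0`
(`IsSchattenApprox.sum_rpow_sub_one_mul_sub_nonneg`).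

If `sᵢ ≤ aᵢ` before place `k`, the positive terms of this sum are at most `s_k^p`. An excess `a_k ≥
s_k + ε` costs at least `ε (s_k + ε)^(p-1)`, too much for large `p`
(`eventually_lt_of_sum_rpow_sub_one_mul_sub_nonneg`). The first place needs no premise; the second
needs `s₁ ≤ a₁`, which lexicographic minimality supplies. Since `s₁ = 1` as a multiplicity, the
second place carries `ρ₂`.

A cluster point of `R_p` is thus a residual with first two singular values at most `ρ₁`, `ρ₂`;
lexicographic minimality forces equality up to place `t₂`, and compactness gives the limit. -/

section KyFan

/-! ### Ky Fan's maximum principle for singular values. -/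

open Module

variable {E F : Type*} [NormedAddCommGroup E] [InnerProductSpace ℂ E] [FiniteDimensional ℂ E]
  [NormedAddCommGroup F] [InnerProductSpace ℂ F] [FiniteDimensional ℂ F]

/-- A finite family of vectors which satisfies Bessel's inequality. -/
def IsBesselFamily {V ι : Type*} [NormedAddCommGroup V] [InnerProductSpace ℂ V] [Fintype ι]
    (u : ι → V) : Prop :=
  ∀ x : V, ∑ i, ‖inner ℂ (u i) x‖ ^ 2 ≤ ‖x‖ ^ 2

namespace IsBesselFamily

variable {V ι : Type*} [NormedAddCommGroup V] [InnerProductSpace ℂ V] [Fintype ι]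

theorem norm_le_one {u : ι → V} (hu : IsBesselFamily u) (i : ι) : ‖u i‖ ≤ 1 := by
  have h1 : ‖inner ℂ (u i) (u i)‖ ^ 2 ≤ ‖u i‖ ^ 2 :=
    (Finset.single_le_sum (f := fun j => ‖inner ℂ (u j) (u i)‖ ^ 2)
      (fun j _ => by positivity) (Finset.mem_univ i)).trans (hu (u i))
  rw [inner_self_eq_norm_sq_to_K, norm_pow, RCLike.norm_ofReal, abs_norm] at h1
  by_contra! h
  have h2 : 1 < ‖u i‖ ^ 2 := by nlinarith
  nlinarith

theorem of_orthonormal {u : ι → V} (hu : Orthonormal ℂ u) : IsBesselFamily u :=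
  fun x => hu.sum_inner_products_le x

theorem of_orthogonal {u : ι → V} (h0 : ∀ i, u i = 0 ∨ ‖u i‖ = 1)
    (hu : ∀ i j, i ≠ j → inner ℂ (u i) (u j) = 0) : IsBesselFamily u := by
  classical
  intro x
  have h : Orthonormal ℂ (fun i : {i // u i ≠ 0} => u i) :=
    ⟨fun i => (h0 i).resolve_left i.2, fun i j hij => hu _ _ fun h => hij (Subtype.ext h)⟩
  refine le_trans (le_of_eq ?_) (h.sum_inner_products_le x (s := Finset.univ))
  rw [← Finset.sum_filter_add_sum_filter_not Finset.univ (fun i => u i ≠ 0),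
    Finset.sum_subtype (Finset.univ.filter fun i => u i ≠ 0) (p := fun i => u i ≠ 0) (by simp)
      (fun i => ‖inner ℂ (u i) x‖ ^ 2)]
  rw [add_eq_left]
  refine Finset.sum_eq_zero fun i hi => ?_
  have : u i = 0 := by simpa using hi
  simp [this]

theorem of_norm_eq_one {x : V} (hx : ‖x‖ = 1) : IsBesselFamily (fun _ : Fin 1 => x) :=
  of_orthogonal (fun _ => Or.inr hx) fun i j hij => (hij (Subsingleton.elim i j)).elim

theorem comp {u : ι → V} (hu : IsBesselFamily u) {κ : Type*} [Fintype κ] {g : κ → ι}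
    (hg : Function.Injective g) : IsBesselFamily (u ∘ g) := by
  classical
  intro x
  refine le_trans ?_ (hu x)
  have := Finset.sum_image (s := Finset.univ) (f := fun i => ‖inner ℂ (u i) x‖ ^ 2) hg.injOn
  simp only [Function.comp_apply]
  rw [← this]
  exact Finset.sum_le_sum_of_subset_of_nonneg (Finset.subset_univ _) fun _ _ _ => by positivity

end IsBesselFamily

/-- The singular value decomposition; the left singular vectors which belong to the singular
value `0` are replaced by `0`. -/
theorem LinearMap.exists_singularValue_decomposition (T : E →ₗ[ℂ] F) :
    ∃ (f : OrthonormalBasis (Fin (finrank ℂ E)) ℂ E) (e : Fin (finrank ℂ E) → F),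
      IsBesselFamily e ∧ (∀ j, T (f j) = (T.singularValues j : ℂ) • e j) ∧
        ∀ j, inner ℂ (e j) (T (f j)) = (T.singularValues j : ℂ) := by
  set hT := T.isSymmetric_adjoint_comp_self
  set f := hT.eigenvectorBasis rfl
  have hin : ∀ i j, inner ℂ (T (f i)) (T (f j)) =
      ((T.singularValues j : ℂ)) ^ 2 * inner ℂ (f i) (f j) := by
    intro i j
    rw [← LinearMap.adjoint_inner_right]
    have := hT.apply_eigenvectorBasis rfl j
    rw [LinearMap.comp_apply] at this
    rw [this, inner_smul_right, ← T.sq_singularValues_fin rfl j]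
    push_cast
    rfl
  have hnorm : ∀ j, ‖T (f j)‖ = T.singularValues j := by
    intro j
    have h := hin j j
    rw [inner_self_eq_norm_sq_to_K, inner_self_eq_norm_sq_to_K, f.orthonormal.1 j] at h
    have h' : ‖T (f j)‖ ^ 2 = T.singularValues j ^ 2 := by
      have : ((‖T (f j)‖ ^ 2 : ℝ) : ℂ) = ((T.singularValues j ^ 2 : ℝ) : ℂ) := by
        push_cast
        simpa using h
      exact_mod_cast this
    exact (pow_left_inj₀ (norm_nonneg _) (T.singularValues_nonneg _) two_ne_zero).mp h'
  -- Since `0⁻¹ = 0`, this vector vanishes when the singular value does.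
  refine ⟨f, fun j => ((T.singularValues j : ℂ))⁻¹ • T (f j), ?_, ?_, ?_⟩
  · apply IsBesselFamily.of_orthogonal
    · intro j
      by_cases h : T.singularValues j = 0
      · left; simp [h]
      · right
        rw [norm_smul, hnorm, norm_inv, Complex.norm_real, Real.norm_of_nonneg
          (T.singularValues_nonneg _), inv_mul_cancel₀ h]
    · intro i j hij
      rw [inner_smul_left, inner_smul_right, hin, f.orthonormal.2 hij]
      simp
  · intro j
    by_cases h : T.singularValues j = 0
    · have : T (f j) = 0 := by rw [← norm_eq_zero, hnorm, h]
      simp [this]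
    · rw [smul_smul, mul_inv_cancel₀ (by exact_mod_cast h), one_smul]
  · intro j
    rw [inner_smul_left, hin, inner_self_eq_norm_sq_to_K, f.orthonormal.1 j]
    by_cases h : T.singularValues j = 0
    · simp [h]
    · have : (T.singularValues j : ℂ) ≠ 0 := by exact_mod_cast h
      simp [pow_two, this]

/-- One half of Ky Fan's maximum principle. -/
theorem LinearMap.sum_re_inner_le_sum_singularValues (T : E →ₗ[ℂ] F) {k : ℕ}
    (hk : k ≤ finrank ℂ E) {u : Fin k → F} {v : Fin k → E} (hu : IsBesselFamily u)
    (hv : IsBesselFamily v) :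
    ∑ i, (inner ℂ (u i) (T (v i))).re ≤ ∑ i ∈ Finset.range k, T.singularValues i := by
  obtain ⟨f, e, he, hfe, -⟩ := T.exists_singularValue_decomposition
  -- The weight that AM-GM puts on the `j`-th singular value; Bessel gives `0 ≤ w j ≤ 1` and total
  -- weight at most `k`.
  set w : Fin (finrank ℂ E) → ℝ := fun j =>
    ∑ i, (‖inner ℂ (u i) (e j)‖ ^ 2 + ‖inner ℂ (v i) (f j)‖ ^ 2) / 2
  have hw1 : ∀ j, w j ≤ 1 := by
    intro j
    have h1 := hu (e j)
    have h2 := hv (f j)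
    have h3 := he.norm_le_one j
    rw [f.orthonormal.1 j] at h2
    have h4 : ‖e j‖ ^ 2 ≤ 1 := pow_le_one₀ (norm_nonneg _) h3
    simp only [w, ← Finset.sum_div, Finset.sum_add_distrib]
    linarith
  have hw0 : ∀ j, 0 ≤ w j := fun j => Finset.sum_nonneg fun i _ => by positivity
  have hwk : ∑ j, w j ≤ k := by
    simp only [w]
    rw [Finset.sum_comm]
    calc _ ≤ ∑ i : Fin k, (1 : ℝ) := by
          refine Finset.sum_le_sum fun i _ => ?_
          have h1 := he (u i)
          have h2 := (IsBesselFamily.of_orthonormal f.orthonormal) (v i)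
          have h3 : ‖u i‖ ^ 2 ≤ 1 := pow_le_one₀ (norm_nonneg _) (hu.norm_le_one i)
          have h4 : ‖v i‖ ^ 2 ≤ 1 := pow_le_one₀ (norm_nonneg _) (hv.norm_le_one i)
          simp only [← Finset.sum_div, Finset.sum_add_distrib]
          simp only [norm_inner_symm (e _), norm_inner_symm (f _)] at h1 h2
          linarith
      _ = k := by simp
  have hle : ∑ i, (inner ℂ (u i) (T (v i))).re ≤ ∑ j : Fin (finrank ℂ E), T.singularValues j * w j := by
    simp only [w, Finset.mul_sum]
    rw [Finset.sum_comm]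
    refine Finset.sum_le_sum fun i _ => ?_
    have hTv : T (v i) = ∑ j, inner ℂ (f j) (v i) • ((T.singularValues j : ℂ) • e j) := by
      conv_lhs => rw [← f.sum_repr (v i), map_sum]
      refine Finset.sum_congr rfl fun j _ => ?_
      rw [map_smul, hfe, f.repr_apply_apply]
    rw [hTv, inner_sum, Complex.re_sum]
    refine Finset.sum_le_sum fun j _ => ?_
    refine (Complex.re_le_norm _).trans ?_
    rw [inner_smul_right, inner_smul_right, norm_mul, norm_mul, Complex.norm_real,
      Real.norm_of_nonneg (T.singularValues_nonneg _), norm_inner_symm (f j)]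
    have := T.singularValues_nonneg j
    nlinarith [mul_nonneg this (sq_nonneg (‖inner ℂ (u i) (e j)‖ - ‖inner ℂ (v i) (f j)‖))]
  have hsum : ∑ i ∈ Finset.range k, T.singularValues i =
      ∑ j : Fin (finrank ℂ E), T.singularValues j * (if (j : ℕ) < k then 1 else 0) := by
    rw [Fin.sum_univ_eq_sum_range (fun j => T.singularValues j * (if j < k then (1 : ℝ) else 0)) (finrank ℂ E)]
    rw [← Finset.sum_subset (Finset.range_mono hk) (fun x _ hx => by
      rw [if_neg (by simpa using hx), mul_zero])]
    exact Finset.sum_congr rfl fun x hx => by rw [if_pos (by simpa using hx), mul_one]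
  have hcard : ∑ j : Fin (finrank ℂ E), (if (j : ℕ) < k then (1 : ℝ) else 0) = k := by
    rw [Fin.sum_univ_eq_sum_range (fun j => (if j < k then (1 : ℝ) else 0)) (finrank ℂ E)]
    rw [← Finset.sum_subset (Finset.range_mono hk) (fun x _ hx => by
      rw [if_neg (by simpa using hx)])]
    rw [Finset.sum_congr rfl fun x hx => if_pos (by simpa using hx)]
    simp
  refine hle.trans ?_
  rw [hsum, ← sub_nonneg, ← Finset.sum_sub_distrib]
  -- Moving all weight to the first `k` places is optimal: compare each singular value with the
  -- threshold `T.singularValues k`.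
  calc (0 : ℝ) ≤ T.singularValues k * (k - ∑ j, w j) :=
        mul_nonneg (T.singularValues_nonneg _) (by linarith)
    _ = ∑ j : Fin (finrank ℂ E), T.singularValues k * ((if (j : ℕ) < k then 1 else 0) - w j) := by
        rw [← Finset.mul_sum, Finset.sum_sub_distrib, hcard]
    _ ≤ _ := by
        refine Finset.sum_le_sum fun j _ => ?_
        rw [← mul_sub]
        split_ifs with h
        · exact mul_le_mul_of_nonneg_right (T.singularValues_antitone h.le)
            (by linarith [hw1 j])
        · have := T.singularValues_antitone (not_lt.mp h)
          nlinarith [hw0 j]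

/-- The other half of Ky Fan's maximum principle. -/
theorem LinearMap.exists_sum_singularValues_eq (T : E →ₗ[ℂ] F) {k : ℕ} (hk : k ≤ finrank ℂ E) :
    ∃ (u : Fin k → F) (v : Fin k → E), IsBesselFamily u ∧ IsBesselFamily v ∧
      ∑ i ∈ Finset.range k, T.singularValues i = ∑ i, (inner ℂ (u i) (T (v i))).re := by
  obtain ⟨f, e, he, -, hfe⟩ := T.exists_singularValue_decomposition
  refine ⟨e ∘ Fin.castLE hk, f ∘ Fin.castLE hk, he.comp (Fin.castLE_injective hk),
    (IsBesselFamily.of_orthonormal f.orthonormal).comp (Fin.castLE_injective hk), ?_⟩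
  simp only [Function.comp_apply, hfe, Fin.val_castLE, Complex.ofReal_re]
  exact (Fin.sum_univ_eq_sum_range (fun i => T.singularValues i) k).symm

/-- Families extremal for the combination are merely admissible for `S` and `T`. -/
theorem LinearMap.sum_singularValues_combination_le (S T : E →ₗ[ℂ] F) {a b : ℝ} (ha : 0 ≤ a)
    (hb : 0 ≤ b) {k : ℕ} (hk : k ≤ finrank ℂ E) :
    ∑ i ∈ Finset.range k, ((a : ℂ) • S + (b : ℂ) • T).singularValues i ≤
      a * ∑ i ∈ Finset.range k, S.singularValues i +
        b * ∑ i ∈ Finset.range k, T.singularValues i := by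
  obtain ⟨u, v, hu, hv, h⟩ := ((a : ℂ) • S + (b : ℂ) • T).exists_sum_singularValues_eq hk
  have h1 := mul_le_mul_of_nonneg_left (S.sum_re_inner_le_sum_singularValues hk hu hv) ha
  have h2 := mul_le_mul_of_nonneg_left (T.sum_re_inner_le_sum_singularValues hk hu hv) hb
  rw [h]
  refine le_trans (le_of_eq ?_) (add_le_add h1 h2)
  rw [Finset.mul_sum, Finset.mul_sum, ← Finset.sum_add_distrib]
  refine Finset.sum_congr rfl fun i _ => ?_
  simp

theorem LinearMap.sum_singularValues_le_mul_norm (T : E →L[ℂ] F) {k : ℕ}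
    (hk : k ≤ finrank ℂ E) :
    ∑ i ∈ Finset.range k, (T : E →ₗ[ℂ] F).singularValues i ≤ k * ‖T‖ := by
  obtain ⟨u, v, hu, hv, h⟩ := (T : E →ₗ[ℂ] F).exists_sum_singularValues_eq hk
  rw [h]
  calc _ ≤ ∑ i : Fin k, ‖T‖ := by
        refine Finset.sum_le_sum fun i _ => (Complex.re_le_norm _).trans ?_
        refine (norm_inner_le_norm _ _).trans ?_
        have h1 : ‖T (v i)‖ ≤ ‖T‖ * 1 :=
          (T.le_opNorm _).trans (mul_le_mul_of_nonneg_left (hv.norm_le_one i) (norm_nonneg _))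
        have := mul_le_mul (hu.norm_le_one i) h1 (norm_nonneg _) zero_le_one
        simpa using this
    _ = _ := by simp

theorem LinearMap.opNorm_le_singularValues_zero (T : E →L[ℂ] F) :
    ‖T‖ ≤ (T : E →ₗ[ℂ] F).singularValues 0 := by
  refine T.opNorm_le_of_unit_norm ((T : E →ₗ[ℂ] F).singularValues_nonneg 0) fun v hv => ?_
  by_cases h0 : T v = 0
  · rw [h0, norm_zero]
    exact (T : E →ₗ[ℂ] F).singularValues_nonneg 0
  have hE : 1 ≤ finrank ℂ E := by
    have : Nontrivial E := ⟨v, 0, fun h => by simp [h] at h0⟩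
    exact finrank_pos
  have hu : ‖((‖T v‖⁻¹ : ℝ) : ℂ) • T v‖ = 1 := by
    rw [norm_smul, Complex.norm_real, norm_inv, norm_norm,
      inv_mul_cancel₀ (norm_ne_zero_iff.mpr h0)]
  have := (T : E →ₗ[ℂ] F).sum_re_inner_le_sum_singularValues hE
    (IsBesselFamily.of_norm_eq_one hu) (IsBesselFamily.of_norm_eq_one hv)
  simp only [Finset.univ_unique, Finset.sum_const, Finset.card_singleton, one_smul,
    Finset.range_one, Finset.sum_singleton, ContinuousLinearMap.coe_coe, inner_smul_left,
    Complex.conj_ofReal, inner_self_eq_norm_sq_to_K] at this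
  refine le_trans (le_of_eq ?_) this
  have hne := norm_ne_zero_iff.mpr h0
  change ‖T v‖ = (((‖T v‖⁻¹ : ℝ) : ℂ) * ((‖T v‖ : ℝ) : ℂ) ^ 2).re
  rw [← Complex.ofReal_pow, ← Complex.ofReal_mul, Complex.ofReal_re]
  field_simp

end KyFan

/-! ### Majorization and inequalities for sums of powers. -/

theorem Finset.sum_mul_nonneg_of_antitone_of_partialSums_nonneg {w d : ℕ → ℝ} (hw : Antitone w)
    (hw0 : ∀ i, 0 ≤ w i) {N : ℕ} (hd : ∀ k ≤ N, 0 ≤ ∑ i ∈ Finset.range k, d i) :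
    0 ≤ ∑ i ∈ Finset.range N, w i * d i := by
  have key : ∀ k ≤ N, w k * ∑ i ∈ Finset.range k, d i ≤ ∑ i ∈ Finset.range k, w i * d i := by
    intro k
    induction k with
    | zero => simp
    | succ k ih =>
      intro hk
      rw [Finset.sum_range_succ (fun i => w i * d i)]
      have h1 := mul_le_mul_of_nonneg_right (hw k.le_succ) (hd _ hk)
      have h2 := ih (k.le_succ.trans hk)
      rw [Finset.sum_range_succ] at h1 ⊢
      simp only [Nat.succ_eq_add_one] at h1
      linarith
  exact (mul_nonneg (hw0 N) (hd N le_rfl)).trans (key N le_rfl)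

/-- The tangent line of a convex power at `y`, which is Bernoulli's inequality for `x / y`. -/
theorem Real.rpow_add_mul_sub_le_rpow {x y p : ℝ} (hx : 0 ≤ x) (hy : 0 ≤ y) (hp : 1 < p) :
    y ^ p + p * (y ^ (p - 1) * (x - y)) ≤ x ^ p := by
  rcases hy.eq_or_lt with rfl | hy
  · rw [Real.zero_rpow (by linarith), Real.zero_rpow (by linarith)]
    simpa using Real.rpow_nonneg hx p
  · have h := one_add_mul_self_le_rpow_one_add (s := x / y - 1) (by
      have := div_nonneg hx hy.le; linarith) hp.le
    rw [add_sub_cancel, Real.div_rpow hx hy.le, le_div_iff₀ (Real.rpow_pos_of_pos hy p)] at h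
    refine le_trans (le_of_eq ?_) h
    rw [Real.rpow_sub_one hy.ne']
    field_simp

/-- If `c` is weakly majorized by `b`, then `∑ cᵢ ^ p ≤ ∑ bᵢ ^ p`. -/
theorem Finset.sum_rpow_le_of_weakly_majorized {b c : ℕ → ℝ} (hb : ∀ i, 0 ≤ b i)
    (hc : Antitone c) (hc0 : ∀ i, 0 ≤ c i) {N : ℕ} {p : ℝ} (hp : 1 < p)
    (h : ∀ k ≤ N, ∑ i ∈ Finset.range k, c i ≤ ∑ i ∈ Finset.range k, b i) :
    ∑ i ∈ Finset.range N, c i ^ p ≤ ∑ i ∈ Finset.range N, b i ^ p := by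
  have h1 : 0 ≤ ∑ i ∈ Finset.range N, c i ^ (p - 1) * (b i - c i) := by
    apply Finset.sum_mul_nonneg_of_antitone_of_partialSums_nonneg
    · exact fun i j hij => Real.rpow_le_rpow (hc0 j) (hc hij) (by linarith)
    · exact fun i => Real.rpow_nonneg (hc0 i) _
    · intro k hk
      rw [Finset.sum_sub_distrib]
      exact sub_nonneg.mpr (h k hk)
  have h2 := Finset.sum_le_sum fun i (_ : i ∈ Finset.range N) =>
    Real.rpow_add_mul_sub_le_rpow (hb i) (hc0 i) hp
  rw [Finset.sum_add_distrib, ← Finset.mul_sum] at h2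
  nlinarith

/-- The first order condition for a minimum of `∑ ((1 - t) aᵢ + t sᵢ) ^ p` at `t = 0`. -/
theorem Finset.sum_rpow_sub_one_mul_sub_nonneg {a s : ℕ → ℝ} (ha : ∀ i, 0 ≤ a i)
    (hs : ∀ i, 0 ≤ s i) {N : ℕ} {p : ℝ} (hp : 1 < p)
    (h : ∀ t ∈ Set.Ioo (0 : ℝ) 1, ∑ i ∈ Finset.range N, a i ^ p ≤
      ∑ i ∈ Finset.range N, ((1 - t) * a i + t * s i) ^ p) :
    0 ≤ ∑ i ∈ Finset.range N, a i ^ (p - 1) * (s i - a i) := by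
  have hcont : Continuous fun t : ℝ =>
      ∑ i ∈ Finset.range N, ((1 - t) * a i + t * s i) ^ (p - 1) * (s i - a i) := by
    refine continuous_finsetSum _ fun i _ => Continuous.mul ?_ continuous_const
    exact Continuous.rpow_const (by fun_prop) fun _ => Or.inr (by linarith)
  have hlim : Tendsto (fun t : ℝ =>
      ∑ i ∈ Finset.range N, ((1 - t) * a i + t * s i) ^ (p - 1) * (s i - a i)) (𝓝[>] 0)
      (𝓝 (∑ i ∈ Finset.range N, a i ^ (p - 1) * (s i - a i))) := by
    have := (hcont.tendsto 0).mono_left (nhdsWithin_le_nhds (s := Set.Ioi 0))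
    simpa using this
  refine ge_of_tendsto hlim ?_
  filter_upwards [Ioo_mem_nhdsGT (zero_lt_one : (0 : ℝ) < 1)] with t ht
  have hb : ∀ i, 0 ≤ (1 - t) * a i + t * s i := fun i =>
    add_nonneg (mul_nonneg (by linarith [ht.2]) (ha i)) (mul_nonneg ht.1.le (hs i))
  -- The tangent is taken at the moved point and evaluated at `a`, so after division by `p * t` only
  -- continuity in `t` is needed.
  have h2 := Finset.sum_le_sum fun i (_ : i ∈ Finset.range N) =>
    Real.rpow_add_mul_sub_le_rpow (ha i) (hb i) hp
  rw [Finset.sum_add_distrib, ← Finset.mul_sum] at h2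
  have h3 : ∑ i ∈ Finset.range N, ((1 - t) * a i + t * s i) ^ (p - 1) *
      (a i - ((1 - t) * a i + t * s i)) =
      -(t * ∑ i ∈ Finset.range N, ((1 - t) * a i + t * s i) ^ (p - 1) * (s i - a i)) := by
    rw [Finset.mul_sum, ← Finset.sum_neg_distrib]
    exact Finset.sum_congr rfl fun i _ => by ring
  rw [h3] at h2
  have h4 := h t ht
  have h5 : 0 ≤ p * (t * ∑ i ∈ Finset.range N,
    ((1 - t) * a i + t * s i) ^ (p - 1) * (s i - a i)) := by linarith
  exact nonneg_of_mul_nonneg_right (nonneg_of_mul_nonneg_right h5 (by linarith)) ht.1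

/-! ### Upper bounds for large `p`. -/

theorem mul_rpow_le_of_sum_rpow_sub_one_mul_sub_nonneg {a s : ℕ → ℝ} (ha : ∀ i, 0 ≤ a i)
    (hs : ∀ i, 0 ≤ s i) (hs' : Antitone s) {N k : ℕ} (hk : k < N) {p ε : ℝ} (hp : 1 < p)
    (hε : 0 < ε) (hlt : ∀ i < k, s i ≤ a i) (hak : s k + ε ≤ a k)
    (h : 0 ≤ ∑ i ∈ Finset.range N, a i ^ (p - 1) * (s i - a i)) :
    ε * (s k + ε) ^ (p - 1) ≤ N * (s k ^ (p - 1) * s k) := by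
  have hp' : 0 ≤ p - 1 := by linarith
  have hC : 0 ≤ s k ^ (p - 1) * s k := mul_nonneg (Real.rpow_nonneg (hs k) _) (hs k)
  have hterm : ∀ i, a i ^ (p - 1) * (s i - a i) ≤ s k ^ (p - 1) * s k := by
    intro i
    have h0 : 0 ≤ a i ^ (p - 1) := Real.rpow_nonneg (ha i) _
    by_cases hi : s i ≤ a i
    · exact (mul_nonpos_of_nonneg_of_nonpos h0 (by linarith)).trans hC
    -- A positive term has `a i < s i ≤ s k`, so both of its factors are controlled by `s k`.
    · have hki : k ≤ i := by
        by_contra! hik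
        exact hi (hlt i hik)
      have h1 := hs' hki
      exact mul_le_mul (Real.rpow_le_rpow (ha i) (by linarith) hp') (by linarith [ha i])
        (by linarith) (Real.rpow_nonneg (hs k) _)
  have hkN : k ∈ Finset.range N := Finset.mem_range.mpr hk
  rw [← Finset.add_sum_erase _ _ hkN] at h
  have h1 : ∑ i ∈ (Finset.range N).erase k, a i ^ (p - 1) * (s i - a i) ≤
      N * (s k ^ (p - 1) * s k) := by
    refine (Finset.sum_le_sum fun i _ => hterm i).trans ?_
    rw [Finset.sum_const, nsmul_eq_mul]
    refine mul_le_mul_of_nonneg_right ?_ hC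
    exact_mod_cast (Finset.card_erase_le).trans (Finset.card_range N).le
  have h2 : (s k + ε) ^ (p - 1) * ε ≤ a k ^ (p - 1) * (a k - s k) :=
    mul_le_mul (Real.rpow_le_rpow (by linarith [hs k]) hak hp') (by linarith) hε.le
      (Real.rpow_nonneg (ha k) _)
  nlinarith

/-- The ratio `s k / (s k + ε)` is below `1`, so its powers beat the fixed factor `N * s k`. -/
theorem eventually_lt_of_sum_rpow_sub_one_mul_sub_nonneg {a : ℝ → ℕ → ℝ} {s : ℕ → ℝ}
    (ha : ∀ p i, 0 ≤ a p i) (hs : ∀ i, 0 ≤ s i) (hs' : Antitone s) {N k : ℕ} (hk : k < N)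
    (hlt : ∀ p, 1 < p → ∀ i < k, s i ≤ a p i)
    (h : ∀ p, 1 < p → 0 ≤ ∑ i ∈ Finset.range N, a p i ^ (p - 1) * (s i - a p i))
    {ε : ℝ} (hε : 0 < ε) : ∀ᶠ p in atTop, a p k < s k + ε := by
  have hpos : 0 < s k + ε := by linarith [hs k]
  have hlim : Tendsto (fun p : ℝ => N * s k * (s k / (s k + ε)) ^ (p - 1)) atTop
      (𝓝 (N * s k * 0)) := by
    refine Tendsto.const_mul _ ?_
    refine (tendsto_rpow_atTop_of_base_lt_one _ ?_ ?_).comp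
      (tendsto_atTop_add_const_right _ (-1) tendsto_id)
    · have := div_nonneg (hs k) hpos.le; linarith
    · rw [div_lt_one hpos]; linarith
  rw [mul_zero] at hlim
  filter_upwards [hlim.eventually_lt_const hε, eventually_gt_atTop 1] with p hp1 hp
  by_contra! hcon
  have h1 := mul_rpow_le_of_sum_rpow_sub_one_mul_sub_nonneg (ha p) hs hs' hk hp hε (hlt p hp)
    hcon (h p hp)
  have h2 : 0 < (s k + ε) ^ (p - 1) := Real.rpow_pos_of_pos hpos _
  rw [Real.div_rpow (hs k) hpos.le, ← mul_div_assoc, div_lt_iff₀ h2] at hp1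
  linarith

/-! ### Continuity and compactness for singular values of matrices. -/

theorem continuous_sum_singularValues {E F : Type*} [NormedAddCommGroup E]
    [InnerProductSpace ℂ E] [FiniteDimensional ℂ E] [NormedAddCommGroup F] [InnerProductSpace ℂ F]
    [FiniteDimensional ℂ F] {k : ℕ} (hk : k ≤ Module.finrank ℂ E) :
    Continuous fun T : E →L[ℂ] F =>
      ∑ i ∈ Finset.range k, (T : E →ₗ[ℂ] F).singularValues i := by
  refine (LipschitzWith.of_le_add_mul (k : NNReal) fun S T => ?_).continuous
  have h1 := LinearMap.sum_singularValues_combination_le (T : E →ₗ[ℂ] F) ((S - T : E →L[ℂ] F) :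
    E →ₗ[ℂ] F) zero_le_one zero_le_one hk
  have h2 := LinearMap.sum_singularValues_le_mul_norm (S - T) hk
  have h3 : ((1 : ℝ) : ℂ) • (T : E →ₗ[ℂ] F) + ((1 : ℝ) : ℂ) • ((S - T : E →L[ℂ] F) : E →ₗ[ℂ] F) =
      (S : E →ₗ[ℂ] F) := by
    ext x
    simp
  rw [h3, one_mul, one_mul] at h1
  rw [dist_eq_norm]
  simp only [NNReal.coe_natCast]
  linarith

namespace Matrix

variable {m n : ℕ}

/-- A matrix as a continuous linear map between Euclidean spaces. -/
noncomputable def euclideanCLMEquiv (m n : ℕ) : Matrix (Fin m) (Fin n) ℂ ≃ₗ[ℂ]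
    (EuclideanSpace ℂ (Fin n) →L[ℂ] EuclideanSpace ℂ (Fin m)) :=
  toEuclideanLin.trans LinearMap.toContinuousLinearMap

theorem coe_euclideanCLMEquiv (A : Matrix (Fin m) (Fin n) ℂ) :
    ((euclideanCLMEquiv m n A : EuclideanSpace ℂ (Fin n) →L[ℂ] EuclideanSpace ℂ (Fin m)) :
      EuclideanSpace ℂ (Fin n) →ₗ[ℂ] EuclideanSpace ℂ (Fin m)) = toEuclideanLin A :=
  rfl

/-- A singular value is a difference of consecutive Ky Fan sums, each of them Lipschitz. -/
theorem continuous_singularValueVec_apply (i : Fin (min m n)) :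
    Continuous fun A : Matrix (Fin m) (Fin n) ℂ => A.singularValueVec i := by
  have hΦ : Continuous (euclideanCLMEquiv m n) :=
    (euclideanCLMEquiv m n).toLinearMap.continuous_of_finiteDimensional
  have hi : (i : ℕ) + 1 ≤ Module.finrank ℂ (EuclideanSpace ℂ (Fin n)) := by
    rw [finrank_euclideanSpace_fin]
    have := i.2
    omega
  have h := ((continuous_sum_singularValues (F := EuclideanSpace ℂ (Fin m)) hi).comp hΦ).sub
    ((continuous_sum_singularValues (F := EuclideanSpace ℂ (Fin m))
      ((Nat.le_succ _).trans hi)).comp hΦ)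
  refine h.congr fun A => ?_
  simp only [Pi.sub_apply, Function.comp_apply, Finset.sum_range_succ, add_sub_cancel_left,
    coe_euclideanCLMEquiv]
  rfl

theorem exists_isCompact_singularValues_zero_le (C : ℝ) :
    ∃ K : Set (Matrix (Fin m) (Fin n) ℂ), IsCompact K ∧
      ∀ A : Matrix (Fin m) (Fin n) ℂ, (toEuclideanLin A).singularValues 0 ≤ C → A ∈ K := by
  have : ProperSpace (EuclideanSpace ℂ (Fin n) →L[ℂ] EuclideanSpace ℂ (Fin m)) :=
    FiniteDimensional.proper ℂ _
  refine ⟨(euclideanCLMEquiv m n).symm '' Metric.closedBall 0 C,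
    (isCompact_closedBall _ _).image
      (euclideanCLMEquiv m n).symm.toLinearMap.continuous_of_finiteDimensional, fun A hA => ?_⟩
  refine ⟨euclideanCLMEquiv m n A, ?_, LinearEquiv.symm_apply_apply _ _⟩
  rw [mem_closedBall_zero_iff]
  exact (LinearMap.opNorm_le_singularValues_zero _).trans hA

theorem singularValueVec_antitone (A : Matrix (Fin m) (Fin n) ℂ) : Antitone A.singularValueVec :=
  fun _ _ h => (toEuclideanLin A).singularValues_antitone h

theorem sum_singularValueVec_rpow (A : Matrix (Fin m) (Fin n) ℂ) (p : ℝ) :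
    ∑ i, A.singularValueVec i ^ p =
      ∑ i ∈ Finset.range (min m n), (toEuclideanLin A).singularValues i ^ p :=
  Fin.sum_univ_eq_sum_range (fun i => (toEuclideanLin A).singularValues i ^ p) (min m n)

theorem sum_singularValues_rpow_le_of_schattenNorm_le {A B : Matrix (Fin m) (Fin n) ℂ} {p : ℝ}
    (hp : 0 < p) (h : schattenNorm p A ≤ schattenNorm p B) :
    ∑ i ∈ Finset.range (min m n), (toEuclideanLin A).singularValues i ^ p ≤
      ∑ i ∈ Finset.range (min m n), (toEuclideanLin B).singularValues i ^ p := by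
  rw [schattenNorm, schattenNorm, sum_singularValueVec_rpow, sum_singularValueVec_rpow] at h
  exact (Real.rpow_le_rpow_iff
    (Finset.sum_nonneg fun i _ => Real.rpow_nonneg (LinearMap.singularValues_nonneg _ i) _)
    (Finset.sum_nonneg fun i _ => Real.rpow_nonneg (LinearMap.singularValues_nonneg _ i) _)
    (by positivity)).mp h

/-- The first order condition for a best approximation in the Schatten `p`-norm. -/
theorem IsSchattenApprox.sum_rpow_sub_one_mul_sub_nonneg {p : ℝ} (hp : 1 < p)
    {M : Submodule ℝ (Matrix (Fin m) (Fin n) ℂ)} {A X Y : Matrix (Fin m) (Fin n) ℂ}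
    (hY : IsSchattenApprox p M A Y) (hX : X ∈ M) :
    0 ≤ ∑ i ∈ Finset.range (min m n), (toEuclideanLin (A - Y)).singularValues i ^ (p - 1) *
      ((toEuclideanLin (A - X)).singularValues i - (toEuclideanLin (A - Y)).singularValues i) := by
  refine Finset.sum_rpow_sub_one_mul_sub_nonneg (LinearMap.singularValues_nonneg _)
    (LinearMap.singularValues_nonneg _) hp fun t ht => ?_
  have h1t : 0 ≤ 1 - t := by linarith [ht.2]
  set Z := (1 - t) • Y + t • X
  have hZ : Z ∈ M := M.add_mem (M.smul_mem _ hY.1) (M.smul_mem _ hX)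
  have hAZ : A - Z = ((1 - t : ℝ) : ℂ) • (A - Y) + ((t : ℝ) : ℂ) • (A - X) := by
    ext i j
    simp [Z]
    ring
  refine (sum_singularValues_rpow_le_of_schattenNorm_le (by linarith) (hY.2 Z hZ)).trans ?_
  refine Finset.sum_rpow_le_of_weakly_majorized (fun i => ?_)
    (LinearMap.singularValues_antitone _) (LinearMap.singularValues_nonneg _) hp fun k hk => ?_
  · exact add_nonneg (mul_nonneg h1t (LinearMap.singularValues_nonneg _ i))
      (mul_nonneg ht.1.le (LinearMap.singularValues_nonneg _ i))
  · rw [hAZ, map_add, map_smul, map_smul, Finset.sum_add_distrib, ← Finset.mul_sum,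
      ← Finset.mul_sum]
    exact LinearMap.sum_singularValues_combination_le _ _ h1t ht.1.le (by
      rw [finrank_euclideanSpace_fin]; exact hk.trans (min_le_right _ _))

/-! ### Lexicographic comparison. -/

theorem toLex_le_cases {N : ℕ} {x y : Fin N → ℝ} (h : toLex x ≤ toLex y) :
    x = y ∨ ∃ j, (∀ i < j, x i = y i) ∧ x j < y j := by
  rcases h.eq_or_lt with h | h
  · exact Or.inl (toLex.injective h)
  · exact Or.inr h

theorem apply_zero_le_of_toLex_le {N : ℕ} {x y : Fin N → ℝ} (h : toLex x ≤ toLex y)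
    {i : Fin N} (hi : (i : ℕ) = 0) : x i ≤ y i := by
  rcases toLex_le_cases h with rfl | ⟨j, hj, hlt⟩
  · exact le_rfl
  · rcases Nat.eq_zero_or_pos (j : ℕ) with h0 | h0
    · rw [show i = j from Fin.ext (hi.trans h0.symm)]
      exact hlt.le
    · exact (hj i (Fin.lt_def.mpr (hi ▸ h0))).le

/-- If `x ≤ y` lexicographically, `y` is non-increasing and `y ≤ x` in the first two places, then
`y` agrees with `x` as long as `x` is constant from the second place on. -/
theorem eq_of_toLex_le_of_le {N : ℕ} {x y : Fin N → ℝ} (hx : Antitone x) (hy : Antitone y)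
    (h : toLex x ≤ toLex y) {i₀ i₁ : Fin N} (h0 : (i₀ : ℕ) = 0) (h1 : (i₁ : ℕ) = 1)
    (hy0 : y i₀ ≤ x i₀) (hy1 : y i₁ ≤ x i₁) {i : Fin N} (hi : x i = x i₁) : y i = x i := by
  rcases toLex_le_cases h with rfl | ⟨j, hj, hlt⟩
  · rfl
  · rcases lt_or_ge i j with hij | hij
    · exact (hj i hij).symm
    · have hj0 : (j : ℕ) ≠ 0 := fun h => by
        rw [show j = i₀ from Fin.ext (h.trans h0.symm)] at hlt
        linarith
      -- At the first difference `j`, `x j < y j ≤ y i₁ ≤ x i₁ = x i ≤ x j`, a contradiction.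
      have h2 : i₁ ≤ j := Fin.le_def.mpr (by omega)
      have := hx hij
      have := hy h2
      linarith

/-! ### Distinct singular values and their multiplicities. -/

theorem singularValueVec_mem_distinctSingularValues (R : Matrix (Fin m) (Fin n) ℂ)
    (i : Fin (min m n)) : R.singularValueVec i ∈ R.distinctSingularValues :=
  Finset.mem_image_of_mem _ (Finset.mem_univ i)

theorem rho_strictAnti (R : Matrix (Fin m) (Fin n) ℂ) : StrictAnti R.rho := fun _ _ h =>
  (R.distinctSingularValues.orderEmbOfFin rfl).strictMono (Fin.rev_lt_rev.mpr h)

theorem exists_rho_eq (R : Matrix (Fin m) (Fin n) ℂ) (i : Fin (min m n)) :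
    ∃ k, R.rho k = R.singularValueVec i := by
  have h := R.singularValueVec_mem_distinctSingularValues i
  rw [← Finset.mem_coe, ← Finset.range_orderEmbOfFin R.distinctSingularValues rfl] at h
  obtain ⟨k, hk⟩ := h
  exact ⟨k.rev, (congrArg (R.distinctSingularValues.orderEmbOfFin rfl) (Fin.rev_rev k)).trans hk⟩

theorem exists_singularValueVec_eq_rho (R : Matrix (Fin m) (Fin n) ℂ) (k : Fin R.numDistinct) :
    ∃ i, R.singularValueVec i = R.rho k := by
  have h : R.rho k ∈ R.distinctSingularValues := Finset.orderEmbOfFin_mem _ rfl _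
  simpa [distinctSingularValues] using h

theorem rhoMultSum_one (R : Matrix (Fin m) (Fin n) ℂ) (hl : 0 < R.numDistinct) :
    R.rhoMultSum 1 = R.rhoMult ⟨0, hl⟩ := by
  rw [rhoMultSum, Finset.sum_eq_single_of_mem ⟨0, hl⟩ (by simp)]
  intro j hj hne
  exact (hne (Fin.ext (by simpa using hj))).elim

theorem rhoMultSum_two (R : Matrix (Fin m) (Fin n) ℂ) (hl : 1 < R.numDistinct) :
    R.rhoMultSum 2 = R.rhoMult ⟨0, zero_lt_one.trans hl⟩ + R.rhoMult ⟨1, hl⟩ := by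
  have : (Finset.univ.filter fun j : Fin R.numDistinct => (j : ℕ) < 2) =
      {⟨0, zero_lt_one.trans hl⟩, ⟨1, hl⟩} := by
    ext j
    simp only [Finset.mem_filter, Finset.mem_univ, true_and, Finset.mem_insert,
      Finset.mem_singleton, Fin.ext_iff]
    omega
  rw [rhoMultSum, this, Finset.sum_pair (by simp)]

/-- If the largest singular value is simple, then the next `rhoMult 1` ones are `rho 1`. -/
theorem singularValueVec_eq_rho_one (R : Matrix (Fin m) (Fin n) ℂ) (hl : 1 < R.numDistinct)
    (hs : R.rhoMult ⟨0, zero_lt_one.trans hl⟩ = 1) {i : Fin (min m n)} (hi : 1 ≤ (i : ℕ))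
    (hi2 : (i : ℕ) < 1 + R.rhoMult ⟨1, hl⟩) : R.singularValueVec i = R.rho ⟨1, hl⟩ := by
  have hanti := R.singularValueVec_antitone
  set i₀ : Fin (min m n) := ⟨0, by omega⟩ with hi₀
  have h0 : R.singularValueVec i₀ = R.rho ⟨0, zero_lt_one.trans hl⟩ := by
    obtain ⟨j, hj⟩ := R.exists_singularValueVec_eq_rho ⟨0, zero_lt_one.trans hl⟩
    obtain ⟨k, hk⟩ := R.exists_rho_eq i₀
    refine le_antisymm ?_ (hj ▸ hanti (Fin.le_def.mpr (Nat.zero_le _)))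
    rw [← hk]
    exact R.rho_strictAnti.antitone (Fin.le_def.mpr (Nat.zero_le _))
  have huniq : ∀ j, R.singularValueVec j = R.rho ⟨0, zero_lt_one.trans hl⟩ → j = i₀ := by
    intro j hj
    rw [rhoMult, Finset.card_eq_one] at hs
    obtain ⟨x, hx⟩ := hs
    have hj' : j ∈ ({x} : Finset _) := hx ▸ by simp [hj]
    have h0' : i₀ ∈ ({x} : Finset _) := hx ▸ by simp [h0]
    rw [Finset.mem_singleton] at hj' h0'
    rw [hj', h0']
  have hne : i ≠ i₀ := fun h => by
    rw [h] at hi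
    simp [hi₀] at hi
  have hle : R.singularValueVec i ≤ R.rho ⟨1, hl⟩ := by
    obtain ⟨k, hk⟩ := R.exists_rho_eq i
    rw [← hk]
    refine R.rho_strictAnti.antitone (Fin.le_def.mpr ?_)
    by_contra! h
    have hk0 : k = ⟨0, zero_lt_one.trans hl⟩ := Fin.ext (by simpa using h)
    exact hne (huniq i (by rw [← hk, hk0]))
  refine le_antisymm hle ?_
  by_contra! hlt
  -- If place `i` lay below `ρ₂`, all places with value `ρ₂` would lie strictly between `0` and `i`:
  -- at most `i - 1` of them, too few.
  have hsub : (Finset.univ.filter fun j => R.singularValueVec j = R.rho ⟨1, hl⟩) ⊆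
      Finset.Ioo i₀ i := by
    intro j hj
    rw [Finset.mem_filter] at hj
    rw [Finset.mem_Ioo]
    constructor
    · refine lt_of_le_of_ne (Fin.le_def.mpr (Nat.zero_le _)) fun h => ?_
      have h1 : R.rho ⟨1, hl⟩ < R.rho ⟨0, zero_lt_one.trans hl⟩ :=
        R.rho_strictAnti (Fin.lt_def.mpr zero_lt_one)
      rw [← hj.2, ← h, h0] at h1
      exact lt_irrefl _ h1
    · by_contra! h
      have := hanti h
      rw [hj.2] at this
      linarith
  have hcard := Finset.card_le_card hsub
  rw [Fin.card_Ioo] at hcard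
  rw [rhoMult] at hi2
  simp only [hi₀] at hcard
  omega

end Matrix

/-! ### The limit. -/

open Matrix in
theorem mainTheorem5 {m n : ℕ} (M : Submodule ℝ (Matrix (Fin m) (Fin n) ℂ))
    (A Yst : Matrix (Fin m) (Fin n) ℂ) (Y : ℝ → Matrix (Fin m) (Fin n) ℂ)
    (hYst : Matrix.IsStrictSpectralApprox M A Yst)
    (hY : ∀ p : ℝ, 1 < p → Matrix.IsSchattenApprox p M A (Y p))
    (hl : 1 < (A - Yst).numDistinct)
    (hs : (A - Yst).rhoMult ⟨0, zero_lt_one.trans hl⟩ = 1) :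
    ∀ i : Fin (min m n), (A - Yst).rhoMultSum 1 ≤ (i : ℕ) → (i : ℕ) < (A - Yst).rhoMultSum 2 →
      Tendsto (fun p : ℝ => (A - Y p).singularValueVec i) atTop
          (𝓝 ((A - Yst).singularValueVec i)) ∧
        (A - Yst).singularValueVec i = (A - Yst).rho ⟨1, hl⟩ := by
  intro i hi1 hi2
  rw [rhoMultSum_one _ (zero_lt_one.trans hl), hs] at hi1
  rw [rhoMultSum_two _ hl, hs] at hi2
  have hval := fun (j : Fin (min m n)) => singularValueVec_eq_rho_one (A - Yst) hl hs (i := j)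
  refine ⟨?_, hval i hi1 hi2⟩
  have hN : 1 < min m n := hi1.trans_lt i.2
  set i₀ : Fin (min m n) := ⟨0, by omega⟩
  set i₁ : Fin (min m n) := ⟨1, hN⟩
  have hii₁ : (A - Yst).singularValueVec i = (A - Yst).singularValueVec i₁ := by
    rw [hval i hi1 hi2, hval i₁ le_rfl (hi1.trans_lt hi2)]
  have hfoc : ∀ p, 1 < p → 0 ≤ ∑ i ∈ Finset.range (min m n),
      (toEuclideanLin (A - Y p)).singularValues i ^ (p - 1) *
      ((toEuclideanLin (A - Yst)).singularValues i -
        (toEuclideanLin (A - Y p)).singularValues i) := fun p hp =>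
    (hY p hp).sum_rpow_sub_one_mul_sub_nonneg hp hYst.1
  have hlim0 : ∀ ε > 0, ∀ᶠ p in atTop,
      (A - Y p).singularValueVec i₀ < (A - Yst).singularValueVec i₀ + ε := fun ε hε =>
    eventually_lt_of_sum_rpow_sub_one_mul_sub_nonneg
      (fun p => LinearMap.singularValues_nonneg _) (LinearMap.singularValues_nonneg _)
      (LinearMap.singularValues_antitone _) i₀.2 (fun p hp j hj => (Nat.not_lt_zero j hj).elim)
      hfoc hε
  have hlim1 : ∀ ε > 0, ∀ᶠ p in atTop,
      (A - Y p).singularValueVec i₁ < (A - Yst).singularValueVec i₁ + ε := fun ε hε =>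
    eventually_lt_of_sum_rpow_sub_one_mul_sub_nonneg
      (fun p => LinearMap.singularValues_nonneg _) (LinearMap.singularValues_nonneg _)
      (LinearMap.singularValues_antitone _) i₁.2 (fun p hp j hj => by
        obtain rfl : j = 0 := Nat.lt_one_iff.mp hj
        exact apply_zero_le_of_toLex_le (hYst.2 _ (hY p hp).1) (i := i₀) rfl)
      hfoc hε
  -- Ultrafilters replace subsequences: along each one the residuals converge to some `R`.
  rw [tendsto_iff_ultrafilter]
  intro g hg
  obtain ⟨K, hK, hmem⟩ := exists_isCompact_singularValues_zero_le (m := m) (n := n)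
    ((A - Yst).singularValueVec i₀ + 1)
  obtain ⟨R, -, hR⟩ := hK.ultrafilter_le_nhds (g.map fun p => A - Y p) (by
    rw [le_principal_iff]
    exact ((hlim0 1 one_pos).filter_mono hg).mono fun p hp => hmem _ hp.le)
  have hR' : Tendsto (fun p => A - Y p) g (𝓝 R) := hR
  have hRM : A - R ∈ M := by
    have h1 : Tendsto (fun p => Y p) g (𝓝 (A - R)) := by
      simpa using (tendsto_const_nhds (x := A)).sub hR'
    exact M.closed_of_finiteDimensional.mem_of_tendsto h1
      (hg ((eventually_gt_atTop 1).mono fun p hp => (hY p hp).1))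
  have hσ : ∀ j, Tendsto (fun p => (A - Y p).singularValueVec j) g (𝓝 (R.singularValueVec j)) :=
    fun j => ((continuous_singularValueVec_apply j).tendsto R).comp hR'
  have hle : ∀ j, (∀ ε > 0, ∀ᶠ p in atTop,
      (A - Y p).singularValueVec j < (A - Yst).singularValueVec j + ε) →
      R.singularValueVec j ≤ (A - Yst).singularValueVec j := fun j hj =>
    le_of_forall_pos_le_add fun ε hε =>
      le_of_tendsto (hσ j) (hg ((hj ε hε).mono fun p hp => hp.le))
  have hlex := hYst.2 _ hRM
  rw [sub_sub_cancel] at hlex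
  -- `R` is the residual of `A - R ∈ M`, so it competes with the strict approximation.
  rw [← eq_of_toLex_le_of_le (singularValueVec_antitone _) (singularValueVec_antitone _) hlex
    (i₀ := i₀) (i₁ := i₁) rfl rfl (hle i₀ hlim0) (hle i₁ hlim1) hii₁]
  exact hσ i
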